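/- Fix a finite non-empty set $\mathsf{P}$ of propositional variables and a countably infinite set $X$ of register variables. A data word is an infinite sequence $w=(P_0,d_0)(P_1,d_1)\dots$ with $P_i\subseteq\mathsf{P}$ and $d_i\in\mathbb{N}$ (the $d_i$ need not be monotone). In what follows $I$ ranges over the open, half-open or closed, possibly unbounded, intervals over $\mathbb{Z}$ (with integer or infinite endpoints). Formulas of MTL are given by $\varphi::=p\mid\neg\varphi\mid\varphi_1\wedge\varphi_2\mid\varphi_1\mathsf{U}_I\varphi_2$ with $p\in\mathsf{P}$. At a position $i\in\mathbb{N}$, $(w,i)\models p$ iff $p\in P_i$, the Boolean connectives have their usual meaning, and $(w,i)\models\varphi_1\mathsf{U}_I\varphi_2$ iff there is $j>i$ with $(w,j)\models\varphi_2$, $d_j-d_i\in I$, and $(w,k)\models\varphi_1$ for all $i<k<j$. The language $L(\varphi)$ is the set of data words $w$ with $(w,0)\models\varphi$. Formulas of TPTL are given by $\varphi::=p\mid x\in I\mid\neg\varphi\mid\varphi_1\wedge\varphi_2\mid\varphi_1\mathsf{U}\varphi_2\mid x.\varphi$ with $p\in\mathsf{P}$, $x\in X$. They are evaluated at a position $i$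 under a valuation $\nu:X\to\mathbb{N}$: propositional variables and Boolean connectives as before; $(w,i,\nu)\models x\in I$ iff $d_i-\nu(x)\in I$; $(w,i,\nu)\models x.\varphi$ iff $(w,i,\nu[x\mapsto d_i])\models\varphi$; and $(w,i,\nu)\models\varphi_1\mathsf{U}\varphi_2$ iff there is $j>i$ with $(w,j,\nu)\models\varphi_2$ and $(w,k,\nu)\models\varphi_1$ for all $i<k<j$. The language $L(\varphi)$ is the set of data words $w$ with $(w,0,\bar 0)\models\varphi$, where $\bar 0$ is the valuation that maps every register variable to $d_0$. Theorem. The following problem is undecidable: given a TPTL formula $\varphi$ over $\mathsf{P}$, is $\varphi$ definable in MTL, that is, is there an MTL formula $\psi$ over $\mathsf{P}$ with $L(\psi)=L(\varphi)$? (Formulas are given through a standard effective numbering.) -/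

import Mathlib

namespace DataLogic

/-- A data word over the set `Fin m` of propositional variables: an infinite sequence of pairs
`(P_i, d_i)` with `P_i` a set of propositional variables and `d_i` a natural number. -/
abbrev DataWord (m : ℕ) : Type := ℕ → Set (Fin m) × ℕ

/-- The data value `d_i`, as an integer, so that differences may be negative. -/
def DataWord.val {m : ℕ} (w : DataWord m) (i : ℕ) : ℤ := ((w i).2 : ℤ)

/-! ### Intervals over the integers -/

/-- One end of an interval: infinite, an included integer, or an excluded integer. -/
inductive Bound : Type
  | infinite : Bound
  | closedAt (a : ℤ) : Bound
  | openAt (a : ℤ) : Bound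

/-- A (half-)open or (half-)closed, possibly unbounded interval over the integers, given by its
two ends. -/
structure Interval : Type where
  lower : Bound
  upper : Bound

/-- `b.AboveLower n`: the integer `n` respects `b` as a lower bound. -/
def Bound.AboveLower : Bound → ℤ → Prop
  | .infinite, _ => True
  | .closedAt a, n => a ≤ n
  | .openAt a, n => a < n

/-- `b.BelowUpper n`: the integer `n` respects `b` as an upper bound. -/
def Bound.BelowUpper : Bound → ℤ → Prop
  | .infinite, _ => True
  | .closedAt a, n => n ≤ a
  | .openAt a, n => n < a

/-- The set of integers that an interval denotes. -/
def Interval.toSet (I : Interval) : Set ℤ :=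
  {n | I.lower.AboveLower n ∧ I.upper.BelowUpper n}

/-! ### Metric temporal logic -/

/-- Formulas of MTL over the propositional variables `Fin m`. -/
inductive MTL (m : ℕ) : Type
  | prop (p : Fin m) : MTL m
  | neg (φ : MTL m) : MTL m
  | and (φ ψ : MTL m) : MTL m
  | untl (I : Interval) (φ ψ : MTL m) : MTL m

/-- `φ.Sat w i` is `(w, i) ⊨ φ`, with the strict until. -/
def MTL.Sat {m : ℕ} : MTL m → DataWord m → ℕ → Prop
  | .prop p, w, i => p ∈ (w i).1
  | .neg φ, w, i => ¬ φ.Sat w i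
  | .and φ ψ, w, i => φ.Sat w i ∧ ψ.Sat w i
  | .untl I φ ψ, w, i => ∃ j, i < j ∧ ψ.Sat w j ∧ w.val j - w.val i ∈ I.toSet ∧
      ∀ k, i < k → k < j → φ.Sat w k

/-- The data language `L(φ)` of an MTL formula. -/
def MTL.language {m : ℕ} (φ : MTL m) : Set (DataWord m) := {w | φ.Sat w 0}

/-! ### Timed propositional temporal logic -/

/-- Formulas of TPTL over the propositional variables `Fin m`, with register variables indexed by
`ℕ`. Here `reg x I` is the atom `x ∈ I` and `freeze x φ` is `x.φ`. -/
inductive TPTL (m : ℕ) : Type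
  | prop (p : Fin m) : TPTL m
  | reg (x : ℕ) (I : Interval) : TPTL m
  | neg (φ : TPTL m) : TPTL m
  | and (φ ψ : TPTL m) : TPTL m
  | untl (φ ψ : TPTL m) : TPTL m
  | freeze (x : ℕ) (φ : TPTL m) : TPTL m

/-- `φ.Sat w i ν` is `(w, i, ν) ⊨ φ`, where `ν` is a register valuation. -/
def TPTL.Sat {m : ℕ} : TPTL m → DataWord m → ℕ → (ℕ → ℕ) → Prop
  | .prop p, w, i, _ => p ∈ (w i).1
  | .reg x I, w, i, ν => w.val i - (ν x : ℤ) ∈ I.toSet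
  | .neg φ, w, i, ν => ¬ φ.Sat w i ν
  | .and φ ψ, w, i, ν => φ.Sat w i ν ∧ ψ.Sat w i ν
  | .untl φ ψ, w, i, ν => ∃ j, i < j ∧ ψ.Sat w j ν ∧ ∀ k, i < k → k < j → φ.Sat w k ν
  | .freeze x φ, w, i, ν => φ.Sat w i (Function.update ν x (w i).2)

/-- The data language `L(φ)` of a TPTL formula: evaluation starts at position `0` with every
register holding the first data value. -/
def TPTL.language {m : ℕ} (φ : TPTL m) : Set (DataWord m) := {w | φ.Sat w 0 fun _ => (w 0).2}

/-- A data language is definable in MTL if it is the language of some MTL formula. -/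
def DefinableInMTL {m : ℕ} (L : Set (DataWord m)) : Prop := ∃ ψ : MTL m, ψ.language = L

/-! ### Effective numbering of the TPTL formulas

Computability of a predicate on formulas refers to the following numbering, built with the
standard pairing function; every natural number is the number of exactly one formula. -/

/-- Ends of intervals, as either nothing or a tagged integer. -/
def Bound.equiv : Bound ≃ Option (ℤ ⊕ ℤ) where
  toFun
    | .infinite => none
    | .closedAt a => some (.inl a)
    | .openAt a => some (.inr a)
  invFun
    | none => .infinite
    | some (.inl a) => .closedAt a
    | some (.inr a) => .openAt a
  left_inv b := by cases b <;> rfl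
  right_inv b := by rcases b with _ | _ | _ <;> rfl

instance : Denumerable Bound := Denumerable.ofEquiv (Option (ℤ ⊕ ℤ)) Bound.equiv

/-- Intervals, as pairs of ends. -/
def Interval.equiv : Interval ≃ Bound × Bound where
  toFun I := (I.lower, I.upper)
  invFun p := ⟨p.1, p.2⟩
  left_inv _ := rfl
  right_inv _ := rfl

instance : Denumerable Interval := Denumerable.ofEquiv (Bound × Bound) Interval.equiv

/-- The number of a TPTL formula. -/
def TPTL.code {m : ℕ} : TPTL m → ℕ
  | .prop p => p
  | .reg x I => m + 5 * Nat.pair x (Encodable.encode I)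
  | .neg φ => m + (5 * φ.code + 1)
  | .and φ ψ => m + (5 * Nat.pair φ.code ψ.code + 2)
  | .untl φ ψ => m + (5 * Nat.pair φ.code ψ.code + 3)
  | .freeze x φ => m + (5 * Nat.pair x φ.code + 4)

theorem TPTL.code_injective {m : ℕ} : Function.Injective (TPTL.code (m := m)) := by
  intro φ
  induction φ with
  | prop p =>
    intro ψ h
    have hp := p.2
    cases ψ <;> simp only [TPTL.code] at h
    case prop q => rw [Fin.ext h]
    all_goals omega
  | reg x I =>
    intro ψ h
    cases ψ <;> simp only [TPTL.code] at h
    case prop q => have := q.2; omega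
    case reg y J =>
      have h' : Nat.pair x (Encodable.encode I) = Nat.pair y (Encodable.encode J) := by omega
      obtain ⟨h1, h2⟩ := Nat.pair_eq_pair.1 h'
      rw [h1, Encodable.encode_injective h2]
    all_goals omega
  | neg φ ih =>
    intro ψ h
    cases ψ <;> simp only [TPTL.code] at h
    case prop q => have := q.2; omega
    case neg ψ => rw [ih (by omega : φ.code = ψ.code)]
    all_goals omega
  | and φ φ' ih ih' =>
    intro ψ h
    cases ψ <;> simp only [TPTL.code] at h
    case prop q => have := q.2; omega
    case and ψ ψ' =>
      have h' : Nat.pair φ.code φ'.code = Nat.pair ψ.code ψ'.code := by omega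
      obtain ⟨h1, h2⟩ := Nat.pair_eq_pair.1 h'
      rw [ih h1, ih' h2]
    all_goals omega
  | untl φ φ' ih ih' =>
    intro ψ h
    cases ψ <;> simp only [TPTL.code] at h
    case prop q => have := q.2; omega
    case untl ψ ψ' =>
      have h' : Nat.pair φ.code φ'.code = Nat.pair ψ.code ψ'.code := by omega
      obtain ⟨h1, h2⟩ := Nat.pair_eq_pair.1 h'
      rw [ih h1, ih' h2]
    all_goals omega
  | freeze x φ ih =>
    intro ψ h
    cases ψ <;> simp only [TPTL.code] at h
    case prop q => have := q.2; omega
    case freeze y ψ =>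
      have h' : Nat.pair x φ.code = Nat.pair y ψ.code := by omega
      obtain ⟨h1, h2⟩ := Nat.pair_eq_pair.1 h'
      rw [h1, ih h2]
    all_goals omega

theorem TPTL.code_surjective {m : ℕ} : Function.Surjective (TPTL.code (m := m)) := by
  intro n
  induction n using Nat.strong_induction_on with
  | _ n ih =>
    rcases lt_or_ge n m with hn | hn
    · exact ⟨.prop ⟨n, hn⟩, rfl⟩
    obtain ⟨k, rfl⟩ := Nat.exists_eq_add_of_le hn
    have hk := Nat.div_add_mod k 5
    have hlt : k % 5 < 5 := Nat.mod_lt _ (by norm_num)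
    have hl := Nat.unpair_left_le (k / 5)
    have hr := Nat.unpair_right_le (k / 5)
    have hp := Nat.pair_unpair (k / 5)
    rcases (by omega : k % 5 = 0 ∨ k % 5 = 1 ∨ k % 5 = 2 ∨ k % 5 = 3 ∨ k % 5 = 4) with
      h | h | h | h | h
    · refine ⟨.reg (k / 5).unpair.1 (Denumerable.ofNat Interval (k / 5).unpair.2), ?_⟩
      simp only [TPTL.code, Denumerable.encode_ofNat]
      omega
    · obtain ⟨φ, hφ⟩ := ih (k / 5) (by omega)
      refine ⟨.neg φ, ?_⟩
      simp only [TPTL.code, hφ]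
      omega
    · obtain ⟨φ, hφ⟩ := ih (k / 5).unpair.1 (by omega)
      obtain ⟨ψ, hψ⟩ := ih (k / 5).unpair.2 (by omega)
      refine ⟨.and φ ψ, ?_⟩
      simp only [TPTL.code, hφ, hψ]
      omega
    · obtain ⟨φ, hφ⟩ := ih (k / 5).unpair.1 (by omega)
      obtain ⟨ψ, hψ⟩ := ih (k / 5).unpair.2 (by omega)
      refine ⟨.untl φ ψ, ?_⟩
      simp only [TPTL.code, hφ, hψ]
      omega
    · obtain ⟨φ, hφ⟩ := ih (k / 5).unpair.2 (by omega)
      refine ⟨.freeze (k / 5).unpair.1 φ, ?_⟩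
      simp only [TPTL.code, hφ]
      omega

/-- The numbering `TPTL.code` as the coding of formulas used by computability theory. -/
noncomputable instance {m : ℕ} : Denumerable (TPTL m) :=
  Denumerable.mk' (Equiv.ofBijective TPTL.code ⟨TPTL.code_injective, TPTL.code_surjective⟩)

theorem TPTL.encode_eq_code {m : ℕ} (φ : TPTL m) : Encodable.encode φ = φ.code := rfl

end DataLogic

/-! The halting problem reduces to non-definability. TPTL can freeze several values and compare
later ones with all of them, so one formula can check a whole derivation written on a data word:
facts are blocks of four values marked by `p`, and every marked fact must follow by a rule from
facts further right. Since there are finitely many marks, this checking is well-founded. Evaluation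
of a partial recursive code is such a rule system (`exists_derivable_rules_iff`); pairing is
computed in unit steps, so tests on differences by constants suffice.

The formula `derives` asks for such a derivation and, in addition, for a data value after the last
mark that recurs three positions later. Without a derivation its language is empty, hence
MTL-definable. With one, an MTL formula is refuted by two words that share the derivation and then
continue with zigzags of amplitude `1` and `2`, scaled by a `K` above all its constants. Amplitude
`1` repeats values at distance three, amplitude `2` does not. An MTL until compares only its own two
ends, so at this scale it sees just the sign of a difference, and every sign reachable in one zigzag
is reachable in the other past intermediate positions of the same kinds (`MTL.sat_zigzagWord`). This
gives `definableInMTL_derives_iff`.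

Fixing one universal code leaves only the input to vary, so the reduction is visibly computable
(`computable_derives`). -/

namespace DataLogic

/-! ### Words that MTL formulas with small constants cannot tell apart -/

/-- `n` and `n'` are equal, or both at least `K`, or both at most `-K`. -/
def Similar (K n n' : ℤ) : Prop := n = n' ∨ (K ≤ n ∧ K ≤ n') ∨ (n ≤ -K ∧ n' ≤ -K)

theorem Similar.mono {K K' n n' : ℤ} (hK : K ≤ K') (h : Similar K' n n') : Similar K n n' := by
  unfold Similar at *; omega

theorem similar_mul {K a a' : ℤ} (hK : 0 < K) (h : a = a' ∨ (0 < a ∧ 0 < a') ∨ (a < 0 ∧ a' < 0)) :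
    Similar K (K * a) (K * a') := by
  rcases h with rfl | ⟨h, h'⟩ | ⟨h, h'⟩
  · exact .inl rfl
  · exact .inr (.inl ⟨by nlinarith, by nlinarith⟩)
  · exact .inr (.inr ⟨by nlinarith, by nlinarith⟩)

/-- `I.Coarse K`: the interval `I` does not distinguish `K`-similar integers. -/
def Interval.Coarse (I : Interval) (K : ℤ) : Prop :=
  ∀ n n', Similar K n n' → n ∈ I.toSet → n' ∈ I.toSet

theorem Bound.exists_coarse (b : Bound) : ∃ K : ℕ, ∀ n n', Similar K n n' →
    (b.AboveLower n → b.AboveLower n') ∧ (b.BelowUpper n → b.BelowUpper n') := by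
  rcases b with _ | a | a
  · exact ⟨0, fun _ _ _ => ⟨id, id⟩⟩
  all_goals
    -- The `+ 1` puts all integers of absolute value at least `K` strictly to one side of `a`, which
    -- covers open and closed ends alike.
    refine ⟨a.natAbs + 1, fun n n' h => ?_⟩
    unfold Similar at h
    simp only [AboveLower, BelowUpper]
    omega

theorem Interval.exists_coarse (I : Interval) : ∃ K : ℕ, I.Coarse K := by
  obtain ⟨K, hK⟩ := I.lower.exists_coarse
  obtain ⟨K', hK'⟩ := I.upper.exists_coarse
  refine ⟨K + K', fun n n' h hn => ⟨(hK n n' (h.mono ?_)).1 hn.1, (hK' n n' (h.mono ?_)).2 hn.2⟩⟩ <;>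
    omega

/-- All intervals of the formula are coarse at scale `K`. -/
def MTL.Coarse {m : ℕ} (K : ℤ) : MTL m → Prop
  | .prop _ => True
  | .neg φ => φ.Coarse K
  | .and φ ψ => φ.Coarse K ∧ ψ.Coarse K
  | .untl I φ ψ => I.Coarse K ∧ φ.Coarse K ∧ ψ.Coarse K

theorem MTL.Coarse.mono {m : ℕ} {K K' : ℤ} (hK : K ≤ K') {φ : MTL m} (h : φ.Coarse K) :
    φ.Coarse K' := by
  induction φ with
  | prop _ => trivial
  | neg φ ih => exact ih h
  | and φ ψ ih ih' => exact ⟨ih h.1, ih' h.2⟩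
  | untl I φ ψ ih ih' => exact ⟨fun n n' hn => h.1 n n' (hn.mono hK), ih h.2.1, ih' h.2.2⟩

theorem MTL.exists_coarse {m : ℕ} (φ : MTL m) : ∃ K : ℕ, φ.Coarse K := by
  induction φ with
  | prop _ => exact ⟨0, trivial⟩
  | neg φ ih => exact ih
  | and φ ψ ih ih' =>
    obtain ⟨⟨K, h⟩, K', h'⟩ := And.intro ih ih'
    exact ⟨K + K', h.mono (by omega), h'.mono (by omega)⟩
  | untl I φ ψ ih ih' =>
    obtain ⟨⟨K, h⟩, ⟨K', h'⟩, K'', h''⟩ := And.intro ih (And.intro ih' I.exists_coarse)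
    exact ⟨K + K' + K'', fun n n' hn => h'' n n' (hn.mono (by omega)), h.mono (by omega),
      h'.mono (by omega)⟩

/-- Positions of words that are related by a symmetric relation with the forth property for the
until modality satisfy the same formulas. -/
theorem MTL.sat_of_bisim {m : ℕ} {ι : Type*} (W : ι → DataWord m) (K : ℤ)
    (Z : ι × ℕ → ι × ℕ → Prop) (symm : ∀ a b, Z a b → Z b a)
    (props : ∀ a b, Z a b → (W a.1 a.2).1 = (W b.1 b.2).1)
    (forth : ∀ a b, Z a b → ∀ j, a.2 < j → ∃ j', b.2 < j' ∧ Z (a.1, j) (b.1, j') ∧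
      Similar K ((W a.1).val j - (W a.1).val a.2) ((W b.1).val j' - (W b.1).val b.2) ∧
      ∀ k', b.2 < k' → k' < j' → ∃ k, a.2 < k ∧ k < j ∧ Z (a.1, k) (b.1, k'))
    {φ : MTL m} (hφ : φ.Coarse K) {a b : ι × ℕ} (h : Z a b) (ha : φ.Sat (W a.1) a.2) :
    φ.Sat (W b.1) b.2 := by
  induction φ generalizing a b with
  | prop p => rw [Sat, ← props a b h]; exact ha
  | neg φ ih => exact fun hb => ha (ih hφ (symm _ _ h) hb)
  | and φ ψ ih ih' => exact ⟨ih hφ.1 h ha.1, ih' hφ.2 h ha.2⟩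
  | untl I φ ψ ih ih' =>
    obtain ⟨j, hj, hψ, hI, hall⟩ := ha
    obtain ⟨j', hj', hZ, hsim, hk⟩ := forth a b h j hj
    refine ⟨j', hj', ih' hφ.2.2 hZ hψ, hφ.1 _ _ hsim hI, fun k' h1 h2 => ?_⟩
    obtain ⟨k, hk1, hk2, hkZ⟩ := hk k' h1 h2
    exact ih hφ.2.1 hkZ (hall k hk1 hk2)

/-- The shape of the zigzag suffix: at even times `2s` the height is `s + c`, at odd times
`2s + 1` it is `s`. -/
def zigzag (c t : ℕ) : ℕ := t / 2 + if t % 2 = 0 then c else 0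

/-- The word that agrees with `u` before position `ℓ` and then continues with a scaled zigzag
without propositional variables. -/
def zigzagWord {m : ℕ} (u : DataWord m) (ℓ B K c : ℕ) : DataWord m := fun i =>
  if i < ℓ then u i else (∅, B + K * zigzag c (i - ℓ))

section

variable {m : ℕ} (u : DataWord m) (ℓ B K c : ℕ)

theorem zigzagWord_of_lt {i : ℕ} (h : i < ℓ) : zigzagWord u ℓ B K c i = u i := if_pos h

theorem zigzagWord_of_le {i : ℕ} (h : ℓ ≤ i) :
    zigzagWord u ℓ B K c i = (∅, B + K * zigzag c (i - ℓ)) := if_neg (by omega)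

theorem zigzagWord_sub {i j : ℕ} (hi : ℓ ≤ i) (hj : ℓ ≤ j) :
    (zigzagWord u ℓ B K c).val j - (zigzagWord u ℓ B K c).val i =
      (K : ℤ) * ((zigzag c (j - ℓ) : ℤ) - zigzag c (i - ℓ)) := by
  simp only [DataWord.val, zigzagWord_of_le _ _ _ _ _ hi, zigzagWord_of_le _ _ _ _ _ hj]
  push_cast
  ring

end

/-- MTL formulas with constants below `K` do not see the amplitude `c ≥ 1` of the zigzag. -/
theorem MTL.sat_zigzagWord {m : ℕ} (u : DataWord m) (ℓ B K c c' : ℕ) (hK : 0 < K)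
    (hB : ∀ i < ℓ, (u i).2 + K ≤ B) (hc : 0 < c) (hc' : 0 < c') {φ : MTL m} (hφ : φ.Coarse K)
    (hℓ : 0 < ℓ) (h : φ.Sat (zigzagWord u ℓ B K c) 0) : φ.Sat (zigzagWord u ℓ B K c') 0 := by
  let W : {c : ℕ // 0 < c} → DataWord m := fun c => zigzagWord u ℓ B K c
  let Z : {c : ℕ // 0 < c} × ℕ → {c : ℕ // 0 < c} × ℕ → Prop := fun a b =>
    -- In the common prefix a position is related only to itself; in the zigzag only the parity of
    -- the offset counts.
    (a.2 = b.2 ∧ a.2 < ℓ) ∨ (ℓ ≤ a.2 ∧ ℓ ≤ b.2 ∧ (a.2 - ℓ) % 2 = (b.2 - ℓ) % 2)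
  refine MTL.sat_of_bisim W K Z ?_ ?_ ?_ hφ (a := (⟨c, hc⟩, 0)) (b := (⟨c', hc'⟩, 0))
    (.inl ⟨rfl, hℓ⟩) h
  · rintro ⟨c, i⟩ ⟨c', i'⟩ h
    simp only [Z] at *
    omega
  · rintro ⟨c, i⟩ ⟨c', i'⟩ (⟨h, h'⟩ | ⟨h, h', -⟩) <;> dsimp only at h h' ⊢
    · subst h
      simp only [W, zigzagWord_of_lt _ _ _ _ _ h']
    · simp only [W, zigzagWord_of_le _ _ _ _ _ h, zigzagWord_of_le _ _ _ _ _ h']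
  · rintro ⟨⟨c, hc⟩, i⟩ ⟨⟨c', hc'⟩, i'⟩ h j hj
    dsimp only at hj ⊢
    rcases h with ⟨h, h'⟩ | ⟨h, h', hpar⟩ <;> dsimp only at h h'
    · subst h
      refine ⟨j, hj, by simp only [Z, true_and, and_true]; omega, ?_,
        fun k hk hkj => ⟨k, hk, hkj, by simp only [Z, true_and, and_true]; omega⟩⟩
      have := hB i h'
      simp only [W, DataWord.val, zigzagWord_of_lt _ _ _ _ _ h']
      rcases lt_or_ge j ℓ with hj | hj
      · simp only [zigzagWord_of_lt _ _ _ _ _ hj]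
        exact .inl rfl
      -- From the prefix into the zigzag, both differences are at least `K` because `B` exceeds
      -- every prefix value by `K`.
      · simp only [zigzagWord_of_le _ _ _ _ _ hj]
        refine .inr (.inl ⟨?_, ?_⟩) <;> push_cast <;> 
          nlinarith [Nat.zero_le (K * zigzag c (j - ℓ)), Nat.zero_le (K * zigzag c' (j - ℓ))]
    · dsimp only at hpar
      obtain ⟨t, rfl⟩ := Nat.exists_eq_add_of_le h
      obtain ⟨t', rfl⟩ := Nat.exists_eq_add_of_le h'
      obtain ⟨s, rfl⟩ := Nat.exists_eq_add_of_le (h.trans hj.le)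
      simp only [Nat.add_sub_cancel_left] at hpar
      -- Differences are multiples of `K`, so agreement in sign suffices. The last clause supplies
      -- partners for the intermediate positions: none if `s' = t' + 1`, one parity if `s' = t' +
      -- 2`, and otherwise both parities, found at `t + 1` and `t + 2`.
      suffices H : ∃ s', t' < s' ∧ s % 2 = s' % 2 ∧
          (let a : ℤ := (zigzag c s : ℤ) - zigzag c t
           let a' : ℤ := (zigzag c' s' : ℤ) - zigzag c' t'
           a = a' ∨ (0 < a ∧ 0 < a') ∨ (a < 0 ∧ a' < 0)) ∧
          (s' ≤ t' + 1 ∨ (s' = t' + 2 ∧ t + 2 ≤ s) ∨ t + 3 ≤ s) by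
        obtain ⟨s', h1, h2, h3, h4⟩ := H
        refine ⟨ℓ + s', by omega, .inr ⟨by simp, by simp, by simpa using h2⟩, ?_, fun k' hk' hks => ?_⟩
        · simp only [W]
          rw [zigzagWord_sub _ _ _ _ _ h (by omega), zigzagWord_sub _ _ _ _ _ h' (by omega)]
          simp only [Nat.add_sub_cancel_left]
          exact similar_mul (by omega) h3
        · by_cases hp : (k' - (ℓ + t')) % 2 = 1
          · refine ⟨ℓ + t + 1, by omega, by omega, .inr ⟨?_, ?_, ?_⟩⟩ <;> dsimp only <;> omega
          · refine ⟨ℓ + t + 2, by omega, by omega, .inr ⟨?_, ?_, ?_⟩⟩ <;> dsimp only <;> omega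
      have hts : t < s := by omega
      simp only [zigzag]
      -- From a peak to a later trough the difference is negative, then zero at distance `2c + 1`,
      -- then positive. The zero and positive cases are answered at distances `2c' + 1` and `2c' +
      -- 3`. In all other cases parity fixes the sign, and the nearest position of the right parity
      -- will do.
      by_cases hp : t % 2 = 0 ∧ s % 2 = 1 ∧ s / 2 ≥ t / 2 + c
      · rcases hp.2.2.eq_or_lt with hp' | hp'
        · exact ⟨t' + 2 * c' + 1, by omega, by omega, by split_ifs <;> omega, by omega⟩
        · exact ⟨t' + 2 * c' + 3, by omega, by omega, by split_ifs <;> omega, by omega⟩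
      · by_cases hq : s % 2 = t % 2
        · exact ⟨t' + 2, by omega, by omega, by split_ifs <;> omega, by omega⟩
        · exact ⟨t' + 1, by omega, by omega, by split_ifs <;> omega, by omega⟩

/-! ### Rule systems over quadruples of natural numbers -/

/-- A fact: a tag and three arguments. -/
abbrev Fact : Type := Fin 4 → ℕ

/-- A condition on a value: its difference to an earlier value, given by index, is in an
interval. -/
abbrev Test : Type := ℕ × Interval

/-- `TestsHold ts ρ v`: the value `v` passes the tests `ts` when `ρ` lists the earlier values. -/
def TestsHold (ts : List Test) (ρ : List ℕ) (v : ℕ) : Prop :=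
  ∀ t ∈ ts, (v : ℤ) - (ρ.getD t.1 0 : ℕ) ∈ t.2.toSet

/-- A pattern for facts: tests for each of the four values. -/
structure Pattern : Type where
  t0 : List Test
  t1 : List Test
  t2 : List Test
  t3 : List Test

/-- `P.Match ρ f`: the fact `f` fits the pattern after the values `ρ`. -/
def Pattern.Match (P : Pattern) (ρ : List ℕ) (f : Fact) : Prop :=
  TestsHold P.t0 ρ (f 0) ∧ TestsHold P.t1 (ρ ++ [f 0]) (f 1) ∧
    TestsHold P.t2 (ρ ++ [f 0, f 1]) (f 2) ∧ TestsHold P.t3 (ρ ++ [f 0, f 1, f 2]) (f 3)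

/-- A sequence of facts fits a sequence of patterns after the values `ρ`. -/
def MatchList : List Pattern → List ℕ → List Fact → Prop
  | [], _, [] => True
  | P :: Ps, ρ, f :: fs => P.Match ρ f ∧ MatchList Ps (ρ ++ [f 0, f 1, f 2, f 3]) fs
  | _, _, _ => False

/-- A rule: a pattern for the conclusion and patterns for the premises. -/
structure Rule : Type where
  head : Pattern
  body : List Pattern

/-- `R.Match h fs`: the rule `R` derives `h` from `fs`. The value with index `0` is zero. -/
def Rule.Match (R : Rule) (h : Fact) (fs : List Fact) : Prop :=
  R.head.Match [0] h ∧ MatchList R.body [0, h 0, h 1, h 2, h 3] fs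

/-- The facts that a rule system derives. -/
inductive Derivable (rs : List Rule) : Fact → Prop
  | intro (R : Rule) (hR : R ∈ rs) (h : Fact) (fs : List Fact) (hm : R.Match h fs)
      (hfs : ∀ f ∈ fs, Derivable rs f) : Derivable rs h

/-- In a justified list every fact follows by a rule from facts that come later. -/
def Justified (rs : List Rule) : List Fact → Prop
  | [] => True
  | h :: L => (∃ R ∈ rs, ∃ fs : List Fact, fs.Sublist L ∧ R.Match h fs) ∧ Justified rs L

theorem Justified.append {rs : List Rule} {L L' : List Fact} (h : Justified rs L)
    (h' : Justified rs L') : Justified rs (L ++ L') := by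
  induction L with
  | nil => exact h'
  | cons f L ih =>
    obtain ⟨⟨R, hR, fs, hfs, hm⟩, hL⟩ := h
    exact ⟨⟨R, hR, fs, hfs.trans (List.sublist_append_left L L'), hm⟩, ih hL⟩

/-- The derivation tree is flattened: the lists of the premises are concatenated, each headed by its
premise, so the premises appear in the order the rule names them. Further facts to the right never
spoil a justification. -/
theorem Derivable.exists_justified {rs : List Rule} {f : Fact} (h : Derivable rs f) :
    ∃ L, Justified rs (f :: L) := by
  induction h with
  | intro R hR h fs hm _ ih =>
    suffices H : ∃ L, fs.Sublist L ∧ Justified rs L by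
      obtain ⟨L, hL, hJ⟩ := H
      exact ⟨L, ⟨R, hR, fs, hL, hm⟩, hJ⟩
    clear hm
    induction fs with
    | nil => exact ⟨[], .slnil, trivial⟩
    | cons g fs ih' =>
      obtain ⟨L, hL, hJ⟩ := ih' (fun f hf => ‹∀ f ∈ g :: fs, Derivable rs f› f (.tail _ hf))
        (fun f hf => ih f (.tail _ hf))
      obtain ⟨L', hJ'⟩ := ih g (.head _)
      exact ⟨g :: (L' ++ L), (hL.trans (List.sublist_append_right L' L)).cons_cons g,
        hJ'.append hJ⟩

/-! ### Derivations as data words -/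

namespace TPTL

variable {m : ℕ} (p : Fin m)

/-- The true formula. -/
def verum : TPTL m := .neg (.and (.prop p) (.neg (.prop p)))

/-- Next. -/
def next (φ : TPTL m) : TPTL m := .untl (.neg (verum p)) φ

/-- At some later position. -/
def eventually (φ : TPTL m) : TPTL m := .untl (verum p) φ

/-- At all positions from the present one on. -/
def globally (φ : TPTL m) : TPTL m := .and φ (.neg (eventually p (.neg φ)))

/-- Disjunction. -/
def or (φ ψ : TPTL m) : TPTL m := .neg (.and (.neg φ) (.neg ψ))

/-- Disjunction over a list. -/
def disj (l : List (TPTL m)) : TPTL m := l.foldr or (.neg (verum p))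

/-- Conjunction of register tests. -/
def tests (ts : List Test) : TPTL m :=
  ts.foldr (fun t φ => .and (.reg t.1 t.2) φ) (verum p)

variable {p} {w : DataWord m} {i : ℕ} {ν : ℕ → ℕ} {φ ψ : TPTL m}

@[simp] theorem sat_verum : (verum p).Sat w i ν := by simp [verum, Sat]

@[simp] theorem sat_next : (next p φ).Sat w i ν ↔ φ.Sat w (i + 1) ν := by
  simp only [next, Sat, sat_verum, not_true_eq_false]
  constructor
  · rintro ⟨j, hj, hφ, hall⟩
    obtain rfl : j = i + 1 := by
      by_contra hne
      exact hall (i + 1) (by omega) (by omega)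
    exact hφ
  · exact fun h => ⟨i + 1, by omega, h, fun k _ _ => by omega⟩

@[simp] theorem sat_eventually : (eventually p φ).Sat w i ν ↔ ∃ j, i < j ∧ φ.Sat w j ν := by
  simp [eventually, Sat]

@[simp] theorem sat_globally : (globally p φ).Sat w i ν ↔ ∀ j, i ≤ j → φ.Sat w j ν := by
  simp only [globally, Sat, sat_eventually, not_exists, not_and, not_not]
  exact ⟨fun h j hj => hj.eq_or_lt.elim (fun e => e ▸ h.1) (h.2 j),
    fun h => ⟨h i le_rfl, fun j hj => h j hj.le⟩⟩

@[simp] theorem sat_or : (or φ ψ).Sat w i ν ↔ φ.Sat w i ν ∨ ψ.Sat w i ν := by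
  simp only [or, Sat]; tauto

@[simp] theorem sat_disj {l : List (TPTL m)} :
    (disj p l).Sat w i ν ↔ ∃ φ ∈ l, φ.Sat w i ν := by
  induction l with
  | nil => simp [disj, Sat]
  | cons φ l ih => simpa [disj] using or_congr_right ih

@[simp] theorem sat_tests {ts : List Test} :
    (tests p ts).Sat w i ν ↔ ∀ t ∈ ts, w.val i - ν t.1 ∈ t.2.toSet := by
  induction ts with
  | nil => simp [tests]
  | cons t ts ih => simpa [tests, Sat] using fun _ => ih

variable (p)

/-- The pattern fits the fact that starts here, and `φ` holds at its last value; the four values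
are stored in the registers from `r` on. -/
def pattern (r : ℕ) (P : Pattern) (φ : TPTL m) : TPTL m :=
  .and (tests p P.t0) <| .freeze r <| next p <|
  .and (tests p P.t1) <| .freeze (r + 1) <| next p <|
  .and (tests p P.t2) <| .freeze (r + 2) <| next p <|
  .and (tests p P.t3) <| .freeze (r + 3) φ

/-- Facts that fit the patterns follow in this order, each marked by `p`. -/
def premises : ℕ → List Pattern → TPTL m
  | _, [] => verum p
  | r, P :: Ps => eventually p (.and (.prop p) (pattern p r P (premises (r + 4) Ps)))

/-- The fact that starts here follows by a rule from later facts. -/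
def justified (rs : List Rule) : TPTL m :=
  disj p (rs.map fun R => pattern p 1 R.head (premises p 5 R.body))

end TPTL

/-- The data value at a position, relative to the first one. -/
def DataWord.rel {m : ℕ} (w : DataWord m) (i : ℕ) : ℕ := (w i).2 - (w 0).2

/-- The fact that starts at a position. -/
def DataWord.fact {m : ℕ} (w : DataWord m) (i : ℕ) : Fact := fun r => w.rel (i + r)

/-- The facts occur in this order after position `i`, without overlap, each marked by `p`. -/
def Located {m : ℕ} (p : Fin m) (w : DataWord m) : ℕ → List Fact → Prop
  | _, [] => True
  | i, f :: fs => ∃ j, i < j ∧ p ∈ (w j).1 ∧ w.fact j = f ∧ Located p w (j + 3) fs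

theorem Located.exists_of_mem {m : ℕ} {p : Fin m} {w : DataWord m} {i : ℕ} {fs : List Fact}
    (h : Located p w i fs) {f : Fact} (hf : f ∈ fs) : ∃ j, i < j ∧ p ∈ (w j).1 ∧ w.fact j = f := by
  induction fs generalizing i with
  | nil => simp at hf
  | cons g fs ih =>
    obtain ⟨j, hj, hp, hg, hL⟩ := h
    rcases List.mem_cons.1 hf with rfl | hf
    · exact ⟨j, hj, hp, hg⟩
    · obtain ⟨k, hk, h⟩ := ih hL hf
      exact ⟨k, by omega, h⟩

section

variable {m : ℕ} {p : Fin m} {w : DataWord m}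

/-- The register valuation in which register `x` holds the value `ρ[x]`, relative to the first
data value, and the unused registers hold the first data value. -/
def valuation (w : DataWord m) (ρ : List ℕ) : ℕ → ℕ := fun x => (w 0).2 + ρ.getD x 0

/-- Registers are written in increasing order, so a freeze appends to the list of values. The lower
bound on `(w i).2` is needed because `DataWord.rel` truncates. -/
theorem update_valuation {r : ℕ} (ρ : List ℕ) (hρ : ρ.length = r) {i : ℕ}
    (hw : (w 0).2 ≤ (w i).2) :
    Function.update (valuation w ρ) r (w i).2 = valuation w (ρ ++ [w.rel i]) := by
  subst hρ
  funext x
  simp only [valuation, DataWord.rel, List.getD_eq_getElem?_getD, Function.update_apply]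
  rcases lt_trichotomy x ρ.length with h | rfl | h
  · rw [if_neg h.ne, List.getElem?_append_left h]
  · simp; omega
  · rw [if_neg h.ne', List.getElem?_eq_none (by omega), List.getElem?_eq_none (by simp; omega)]

theorem TPTL.sat_tests_valuation {ts : List Test} {i : ℕ} {ρ : List ℕ}
    (hw : (w 0).2 ≤ (w i).2) :
    (tests p ts).Sat w i (valuation w ρ) ↔ TestsHold ts ρ (w.rel i) := by
  rw [sat_tests]
  refine forall₂_congr fun t _ => ?_
  rw [show w.val i - (valuation w ρ t.1 : ℕ) = (w.rel i : ℤ) - (ρ.getD t.1 0 : ℕ) by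
    simp only [DataWord.val, DataWord.rel, valuation]; omega]

theorem TPTL.sat_pattern (hw : ∀ i, (w 0).2 ≤ (w i).2) {P : Pattern} {r i : ℕ} {φ : TPTL m}
    {ρ : List ℕ} (hρ : ρ.length = r) :
    (pattern p r P φ).Sat w i (valuation w ρ) ↔ P.Match ρ (w.fact i) ∧
      φ.Sat w (i + 3) (valuation w (ρ ++ [w.fact i 0, w.fact i 1, w.fact i 2, w.fact i 3])) := by
  simp only [pattern, Sat, sat_next]
  rw [update_valuation ρ hρ (hw _), update_valuation _ (by simp [hρ]) (hw _),
    update_valuation _ (by simp [hρ]) (hw _), update_valuation _ (by simp [hρ]) (hw _)]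
  simp only [sat_tests_valuation (hw _), Pattern.Match, DataWord.fact, List.append_assoc,
    List.cons_append, List.nil_append, and_assoc]
  rfl

/-- A pattern hands over at the last value of its fact, so the search for the next premise starts at
`j + 3`, exactly as in `Located`. -/
theorem TPTL.sat_premises (hw : ∀ i, (w 0).2 ≤ (w i).2) {Ps : List Pattern} {r i : ℕ}
    {ρ : List ℕ} (hρ : ρ.length = r) :
    (premises p r Ps).Sat w i (valuation w ρ) ↔
      ∃ fs, Located p w i fs ∧ MatchList Ps ρ fs := by
  induction Ps generalizing r i ρ with
  | nil => simpa [premises] using ⟨[], trivial, trivial⟩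
  | cons P Ps ih =>
    simp only [premises, sat_eventually, Sat, sat_pattern hw hρ]
    constructor
    · rintro ⟨j, hj, hp, hP, h⟩
      obtain ⟨fs, hL, hM⟩ := (ih (by simp [hρ])).1 h
      exact ⟨w.fact j :: fs, ⟨j, hj, hp, rfl, hL⟩, hP, hM⟩
    · rintro ⟨_ | ⟨f, fs⟩, hL, hM⟩
      · exact hM.elim
      · obtain ⟨j, hj, hp, rfl, hL⟩ := hL
        exact ⟨j, hj, hp, hM.1, (ih (by simp [hρ])).2 ⟨fs, hL, hM.2⟩⟩

theorem TPTL.sat_justified (hw : ∀ i, (w 0).2 ≤ (w i).2) {rs : List Rule} {i : ℕ} :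
    (justified p rs).Sat w i (fun _ => (w 0).2) ↔
      ∃ R ∈ rs, ∃ fs, Located p w (i + 3) fs ∧ R.Match (w.fact i) fs := by
  -- Every register starts with the first data value; register `0` is never overwritten by the
  -- patterns and plays the value zero of index `0`.
  have hv : (fun _ => (w 0).2) = valuation w [0] := by
    funext x
    rcases x with _ | x <;> simp [valuation]
  simp only [justified, sat_disj, List.mem_map, exists_exists_and_eq_and, hv,
    sat_pattern hw (show [0].length = 1 from rfl), Rule.Match]
  refine exists_congr fun R => and_congr_right fun _ => ?_
  rw [sat_premises hw (by simp)]
  exact ⟨fun ⟨h, fs, hL, hM⟩ => ⟨fs, hL, h, hM⟩, fun ⟨fs, hL, h, hM⟩ => ⟨h, fs, hL, hM⟩⟩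

end

/-! ### Formulas that define derivations followed by a zigzag -/

/-- The one-element interval. -/
def Interval.single (a : ℤ) : Interval := ⟨.closedAt a, .closedAt a⟩

/-- The interval of the integers that are at least `a`. -/
def Interval.atLeast (a : ℤ) : Interval := ⟨.closedAt a, .infinite⟩

@[simp] theorem Interval.mem_single {a n : ℤ} : n ∈ (single a).toSet ↔ n = a := by
  simp only [single, toSet, Bound.AboveLower, Bound.BelowUpper, Set.mem_ofPred_eq]; omega

@[simp] theorem Interval.mem_atLeast {a n : ℤ} : n ∈ (atLeast a).toSet ↔ a ≤ n := by
  simp [atLeast, toSet, Bound.AboveLower, Bound.BelowUpper]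

namespace TPTL

variable {m : ℕ} (p : Fin m)

/-- No data value is below the first one, all marked facts are justified by later facts, there are
only finitely many, and after the last mark a data value occurs again three positions later. -/
def derivation (rs : List Rule) : TPTL m :=
  .and (globally p (.reg 0 (.atLeast 0))) <|
  .and (globally p (.neg (.and (next p (.prop p)) (.neg (next p (justified p rs)))))) <|
  eventually p (.and (globally p (.neg (.prop p)))
    (.freeze 1 (next p (next p (next p (.reg 1 (.single 0)))))))

/-- A fact with tag `t` and first argument `n` starts at the second position. -/
def query (t n : ℕ) : TPTL m :=
  next p (.and (.prop p) (.and (.reg 0 (.single t)) (next p (.reg 0 (.single n)))))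

/-- The conjunction of `query` and `derivation`. -/
def derives (rs : List Rule) (t n : ℕ) : TPTL m := .and (query p t n) (derivation p rs)

variable {p} {w : DataWord m} {rs : List Rule} {t n : ℕ}

theorem mem_language_derives : w ∈ (derives p rs t n).language ↔
    (p ∈ (w 1).1 ∧ w.fact 1 0 = t ∧ w.fact 1 1 = n) ∧ (∀ i, (w 0).2 ≤ (w i).2) ∧
    (∀ i, p ∈ (w (i + 1)).1 →
      ∃ R ∈ rs, ∃ fs, Located p w (i + 4) fs ∧ R.Match (w.fact (i + 1)) fs) ∧
    ∃ i, 0 < i ∧ (∀ j, i ≤ j → p ∉ (w j).1) ∧ (w (i + 3)).2 = (w i).2 := by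
  have hge : (globally p (.reg 0 (.atLeast 0))).Sat w 0 (fun _ => (w 0).2) ↔
      ∀ i, (w 0).2 ≤ (w i).2 := by
    simp [Sat, DataWord.val]
  have hq (hw : ∀ i, (w 0).2 ≤ (w i).2) : (query p t n).Sat w 0 (fun _ => (w 0).2) ↔
      (p ∈ (w 1).1 ∧ w.fact 1 0 = t ∧ w.fact 1 1 = n) := by
    have h1 := hw 1
    have h2 := hw 2
    simp only [query, sat_next, Sat, DataWord.val, Interval.mem_single, DataWord.fact,
      DataWord.rel, zero_add, Fin.val_zero, Fin.val_one, Nat.reduceAdd, add_zero]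
    refine and_congr_right fun _ => and_congr ?_ ?_ <;> omega
  -- The lower bound on all data values is moved to the front, since the translations of the other
  -- conjuncts depend on it.
  rw [language, Set.mem_ofPred_eq, derives, Sat, derivation, Sat, Sat, hge, and_left_comm,
    and_left_comm (a := _ ∧ _)]
  refine and_congr_right fun hw => ?_
  rw [hq hw]
  refine and_congr_right fun _ => ?_
  simp only [sat_globally, sat_eventually, sat_next, Sat, sat_justified hw, DataWord.val,
    Function.update_self, Interval.mem_single, not_and, not_not, zero_le, forall_const,
    add_assoc, Nat.reduceAdd, sub_eq_zero, Nat.cast_inj]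

theorem exists_derivable (hw : w ∈ (derives p rs t n).language) :
    ∃ f, Derivable rs f ∧ f 0 = t ∧ f 1 = n := by
  obtain ⟨⟨h1, ht, hn⟩, -, hj, N, -, hN, -⟩ := mem_language_derives.1 hw
  refine ⟨w.fact 1, ?_, ht, hn⟩
  -- Premises lie strictly to the right and no mark occurs from `N` on, so `k` bounds the remaining
  -- depth.
  suffices H : ∀ k i, N ≤ i + k → p ∈ (w (i + 1)).1 → Derivable rs (w.fact (i + 1)) from
    H N 0 (by omega) h1
  intro k
  induction k with
  | zero => exact fun i hi hp => absurd hp (hN _ (by omega))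
  | succ k ih =>
    intro i hi hp
    obtain ⟨R, hR, fs, hL, hM⟩ := hj i hp
    refine .intro R hR _ fs hM fun f hf => ?_
    obtain ⟨j, hij, hpj, rfl⟩ := hL.exists_of_mem hf
    obtain ⟨j, rfl⟩ := Nat.exists_eq_add_of_lt (Nat.zero_lt_of_lt hij)
    exact ih (0 + j) (by omega) hpj

end TPTL

/-! ### Data words that realise justified lists -/

theorem Justified.exists_rule {rs : List Rule} {L : List Fact} (h : Justified rs L) {q : ℕ}
    (hq : q < L.length) :
    ∃ R ∈ rs, ∃ fs : List Fact, fs.Sublist (L.drop (q + 1)) ∧ R.Match L[q] fs := by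
  induction L generalizing q with
  | nil => simp at hq
  | cons f L ih =>
    rcases q with _ | q
    · exact h.1
    · exact ih h.2 (by simpa using hq)

/-- Here `q` counts the blocks already passed. After a block is used the search resumes at its last
value, still before the start of block `q + 1`. -/
theorem located_of_sublist {m : ℕ} {p : Fin m} {w : DataWord m} {fs L : List Fact}
    (h : fs.Sublist L) {q i : ℕ} (hi : i < 1 + 4 * q)
    (hL : ∀ k, (hk : k < L.length) → p ∈ (w (1 + 4 * (q + k))).1 ∧
      w.fact (1 + 4 * (q + k)) = L[k]) : Located p w i fs := by
  induction h generalizing q i with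
  | slnil => trivial
  | cons f _ ih =>
    refine ih (q := q + 1) (by omega) fun k hk => ?_
    have := hL (k + 1) (by simpa using hk)
    rwa [← add_assoc, add_right_comm] at this
  | cons_cons f _ ih =>
    obtain ⟨h1, h2⟩ := hL 0 (by simp)
    refine ⟨1 + 4 * q, hi, h1, h2, ih (q := q + 1) (by omega) fun k hk => ?_⟩
    have := hL (k + 1) (by simpa using hk)
    rwa [← add_assoc, add_right_comm] at this

/-- The data word that lists the facts of `L` from position `1` on, marked by `p`. -/
def factWord {m : ℕ} (p : Fin m) (L : List Fact) : DataWord m := fun i =>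
  ({q | q = p ∧ i % 4 = 1},
    if i = 0 then 0 else L.getD ((i - 1) / 4) 0 ⟨(i - 1) % 4, Nat.mod_lt _ (by norm_num)⟩)

section

variable {m : ℕ} {p : Fin m} {L : List Fact} {B K c : ℕ}

theorem fact_zigzagWord {q : ℕ} (hq : q < L.length) :
    p ∈ (zigzagWord (factWord p L) (1 + 4 * L.length) B K c (1 + 4 * q)).1 ∧
      (zigzagWord (factWord p L) (1 + 4 * L.length) B K c).fact (1 + 4 * q) = L[q] := by
  constructor
  · rw [zigzagWord_of_lt _ _ _ _ _ (by omega)]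
    simp only [factWord, Set.mem_ofPred_eq, true_and]
    omega
  · funext r
    have hr := r.2
    simp only [DataWord.fact, DataWord.rel]
    rw [zigzagWord_of_lt _ _ _ _ _ (by omega), zigzagWord_of_lt _ _ _ _ _ (by omega)]
    have h1 : (1 + 4 * q + r - 1) / 4 = q := by omega
    have h2 : (1 + 4 * q + r - 1) % 4 = r := by omega
    simp only [factWord, h1, h2, if_neg (show 1 + 4 * q + r ≠ 0 by omega), if_true, Nat.sub_zero]
    rw [List.getD_eq_getElem _ _ hq]

theorem exists_of_mem_zigzagWord {i : ℕ}
    (h : p ∈ (zigzagWord (factWord p L) (1 + 4 * L.length) B K c i).1) :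
    ∃ q < L.length, i = 1 + 4 * q := by
  rcases lt_or_ge i (1 + 4 * L.length) with hi | hi
  · rw [zigzagWord_of_lt _ _ _ _ _ hi] at h
    have := h.2
    exact ⟨i / 4, by omega, by omega⟩
  · rw [zigzagWord_of_le _ _ _ _ _ hi] at h
    exact h.elim

theorem zigzagWord_mem_language {rs : List Rule} {f : Fact} (hL : Justified rs (f :: L)) :
    zigzagWord (factWord p (f :: L)) (1 + 4 * (f :: L).length) B K 1 ∈
      (TPTL.derives p rs (f 0) (f 1)).language := by
  set L' := f :: L with hL'
  set w := zigzagWord (factWord p L') (1 + 4 * L'.length) B K 1 with hw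
  have hlen : 0 < L'.length := by simp [hL']
  refine TPTL.mem_language_derives.2 ⟨?_, ?_, ?_, ?_⟩
  · obtain ⟨h1, h2⟩ := fact_zigzagWord (p := p) (B := B) (K := K) (c := 1) hlen
    rw [mul_zero, add_zero, ← hw] at h1 h2
    exact ⟨h1, by rw [h2]; rfl, by rw [h2]; rfl⟩
  · intro i
    rw [hw, zigzagWord_of_lt _ _ _ _ _ (by omega)]
    simp [factWord]
  · intro i hi
    obtain ⟨q, hq, hqi⟩ := exists_of_mem_zigzagWord hi
    obtain ⟨R, hR, fs, hfs, hM⟩ := hL.exists_rule hq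
    refine ⟨R, hR, fs, located_of_sublist hfs (q := q + 1) (by omega) fun k hk => ?_, ?_⟩
    · rw [List.getElem_drop]
      exact fact_zigzagWord (by simp at hk; omega)
    · rw [hqi, (fact_zigzagWord hq).2]
      exact hM
  -- The witness is the first zigzag position: with amplitude `1`, offsets `0` and `3` both have
  -- height `1`.
  · refine ⟨1 + 4 * L'.length, by omega, fun j hj => ?_, ?_⟩ <;> rw [hw]
    · simp [zigzagWord_of_le _ _ _ _ _ hj]
    · rw [zigzagWord_of_le _ _ _ _ _ le_rfl, zigzagWord_of_le _ _ _ _ _ (by omega)]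
      simp [zigzag]

theorem zigzagWord_notMem_language {rs : List Rule} {t n : ℕ} (hK : 0 < K)
    (hB : ∀ i < 1 + 4 * L.length, (factWord p L i).2 + K ≤ B) :
    zigzagWord (factWord p L) (1 + 4 * L.length) B K 2 ∉ (TPTL.derives p rs t n).language := by
  intro h
  obtain ⟨-, -, -, i, -, hp, hi⟩ := TPTL.mem_language_derives.1 h
  -- The last mark is four positions before the zigzag, so from any position after it three steps
  -- lead into the zigzag. From the prefix that means a rise of at least `K`; inside a zigzag of
  -- amplitude `2`, heights at distance three differ.
  have hlast : 1 + 4 * L.length ≤ i + 3 := by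
    by_contra! hlt
    exact hp _ (by omega) (fact_zigzagWord (q := L.length - 1) (by omega)).1
  rcases lt_or_ge i (1 + 4 * L.length) with hlt | hge
  · rw [zigzagWord_of_lt _ _ _ _ _ hlt, zigzagWord_of_le _ _ _ _ _ hlast] at hi
    have := hB i hlt
    simp only at hi
    omega
  · rw [zigzagWord_of_le _ _ _ _ _ hge, zigzagWord_of_le _ _ _ _ _ (by omega)] at hi
    have := Nat.eq_of_mul_eq_mul_left hK (Nat.add_left_cancel hi)
    simp only [zigzag] at this
    split_ifs at this <;> omega

end

/-- `derives` defines an MTL-definable language only if it is unsatisfiable. -/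
theorem definableInMTL_derives_iff {m : ℕ} {p : Fin m} {rs : List Rule} {t n : ℕ} :
    DefinableInMTL (TPTL.derives p rs t n).language ↔
      ¬ ∃ f, Derivable rs f ∧ f 0 = t ∧ f 1 = n := by
  constructor
  · rintro ⟨ψ, hψ⟩ ⟨f, hf, rfl, rfl⟩
    obtain ⟨L, hL⟩ := hf.exists_justified
    obtain ⟨K, hK⟩ := ψ.exists_coarse
    let ℓ := 1 + 4 * (f :: L).length
    let B := ∑ i ∈ Finset.range ℓ, (factWord p (f :: L) i).2 + (K + 1)
    have hB : ∀ i < ℓ, (factWord p (f :: L) i).2 + (K + 1) ≤ B := fun i hi =>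
      Nat.add_le_add_right (Finset.single_le_sum (f := fun i => (factWord p (f :: L) i).2)
        (fun _ _ => Nat.zero_le _) (Finset.mem_range.2 hi)) _
    have h1 : zigzagWord (factWord p (f :: L)) ℓ B (K + 1) 1 ∈ ψ.language :=
      hψ ▸ zigzagWord_mem_language hL
    refine zigzagWord_notMem_language (rs := rs) (t := f 0) (n := f 1) (Nat.succ_pos K) hB ?_
    rw [← hψ]
    exact MTL.sat_zigzagWord _ ℓ B (K + 1) 1 2 (Nat.succ_pos K) hB one_pos two_pos
      (hK.mono (by omega)) (by omega) h1
  · refine fun h => ⟨.and (.prop p) (.neg (.prop p)), ?_⟩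
    rw [Set.eq_empty_of_forall_notMem fun w hw => h (TPTL.exists_derivable hw)]
    exact Set.eq_empty_of_forall_notMem fun w hw => hw.2 hw.1

/-! ### A rule system for partial recursive functions -/

open Nat.Partrec (Code)
open Encodable (encode)

@[simp] theorem testsHold_nil {ρ : List ℕ} {v : ℕ} : TestsHold [] ρ v := by simp [TestsHold]

@[simp] theorem matchList_nil {ρ : List ℕ} {fs : List Fact} : MatchList [] ρ fs ↔ fs = [] := by
  cases fs <;> simp [MatchList]

@[simp] theorem matchList_cons {P : Pattern} {Ps : List Pattern} {ρ : List ℕ} {fs : List Fact} :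
    MatchList (P :: Ps) ρ fs ↔ ∃ f gs, fs = f :: gs ∧ P.Match ρ f ∧
      MatchList Ps (ρ ++ [f 0, f 1, f 2, f 3]) gs := by
  cases fs <;> simp [MatchList]

/-- The test for being an earlier value plus a constant. -/
def Test.is (x : ℕ) (k : ℤ := 0) : Test := (x, .single k)

/-- The test for being at least an earlier value plus a constant. -/
def Test.ge (x : ℕ) (k : ℤ := 0) : Test := (x, .atLeast k)

/-- The pattern with a fixed tag and tests for the three arguments. -/
def Pattern.tagged (t : ℕ) (t1 t2 t3 : List Test) : Pattern := ⟨[.is 0 t], t1, t2, t3⟩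

/-- The tag of the facts `![tag c, n, v, _]` that say that `v` is the value of `c` at `n`. -/
def tag (c : Code) : ℕ := encode c + 1

@[simp] theorem testsHold_is {x : ℕ} {k : ℤ} {ts : List Test} {ρ : List ℕ} {v : ℕ} :
    TestsHold (.is x k :: ts) ρ v ↔ (v : ℤ) = (ρ.getD x 0 : ℕ) + k ∧ TestsHold ts ρ v := by
  simp [TestsHold, Test.is, sub_eq_iff_eq_add']

@[simp] theorem testsHold_ge {x : ℕ} {k : ℤ} {ts : List Test} {ρ : List ℕ} {v : ℕ} :
    TestsHold (.ge x k :: ts) ρ v ↔ (ρ.getD x 0 : ℕ) + k ≤ (v : ℤ) ∧ TestsHold ts ρ v := by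
  simp [TestsHold, Test.ge, le_sub_iff_add_le']

@[simp] theorem Pattern.tagged_match {t : ℕ} {t1 t2 t3 : List Test} {ρ : List ℕ} {f : Fact} :
    (Pattern.tagged t t1 t2 t3).Match (0 :: ρ) f ↔ f 0 = t ∧ TestsHold t1 (0 :: ρ ++ [f 0]) (f 1) ∧
      TestsHold t2 (0 :: ρ ++ [f 0, f 1]) (f 2) ∧
        TestsHold t3 (0 :: ρ ++ [f 0, f 1, f 2]) (f 3) := by
  simp [Pattern.tagged, Pattern.Match]

open Pattern Test

/-- Rules for the facts `![0, a, b, c]` that say `c = Nat.pair a b`. -/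
def pairRules : List Rule :=
  -- `Nat.pair` enumerates the plane by square shells; each of the other rules steps from a point to
  -- its predecessor, lowering the value by one.
  [⟨tagged 0 [is 0] [is 0] [is 0], []⟩,
   ⟨tagged 0 [] [ge 2 1] [], [tagged 0 [is 2 (-1)] [is 3] [is 4 (-1)]]⟩,
   ⟨tagged 0 [is 0] [] [], [tagged 0 [is 3 (-1)] [is 3 (-1)] [is 4 (-1)]]⟩,
   -- The condition `b ≤ a` is tested on the premise's copy of `a`, because `ge` needs the smaller
   -- value to come earlier.
   ⟨tagged 0 [] [] [], [tagged 0 [is 2, ge 3] [is 3 (-1)] [is 4 (-1)]]⟩,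
   ⟨tagged 0 [] [is 0] [], [tagged 0 [is 2 (-1)] [is 2] [is 4 (-1)]]⟩]

/-- Rules for the evaluation of a code and its subcodes. -/
def codeRules : Code → List Rule
  -- Indices: `0` is zero, `1` the tag and `2`, `3`, `4` the arguments of the conclusion; the
  -- premises then take four indices each, so their arguments sit at `6`–`8`, `10`–`12`, `14`–`16`
  -- and so on.
  | .zero => [⟨tagged (tag .zero) [] [is 0] [], []⟩]
  | .succ => [⟨tagged (tag .succ) [] [is 2 1] [], []⟩]
  | .left => [⟨tagged (tag .left) [] [] [], [tagged 0 [is 3] [] [is 2]]⟩]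
  | .right => [⟨tagged (tag .right) [] [] [], [tagged 0 [] [is 3] [is 2]]⟩]
  | .pair f g => ⟨tagged (tag (.pair f g)) [] [] [],
      [tagged (tag f) [is 2] [] [], tagged (tag g) [is 2] [] [],
        tagged 0 [is 7] [is 11] [is 3]]⟩ :: (codeRules f ++ codeRules g)
  | .comp f g => ⟨tagged (tag (.comp f g)) [] [] [],
      [tagged (tag g) [is 2] [] [], tagged (tag f) [is 7] [is 3] []]⟩ ::
        (codeRules f ++ codeRules g)
  | .prec f g => ⟨tagged (tag (.prec f g)) [] [] [],
      [tagged 0 [] [is 0] [is 2], tagged (tag f) [is 6] [is 3] []]⟩ ::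
      ⟨tagged (tag (.prec f g)) [] [] [],
        [tagged 0 [] [] [is 2], tagged 0 [is 6] [is 7 (-1)] [],
          tagged (tag (.prec f g)) [is 12] [] [], tagged 0 [is 11] [is 15] [],
          tagged 0 [is 6] [is 20] [], tagged (tag g) [is 24] [is 3] []]⟩ ::
      (codeRules f ++ codeRules g)
  | .rfind' f => ⟨tagged (tag (.rfind' f)) [] [] [],
      [tagged 0 [] [is 3] [is 2], tagged (tag f) [is 2] [is 0] []]⟩ ::
      ⟨tagged (tag (.rfind' f)) [] [] [],
        [tagged 0 [] [] [is 2], tagged (tag f) [is 2] [ge 0 1] [],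
          tagged 0 [is 6] [is 7 1] [], tagged (tag (.rfind' f)) [is 16] [is 3] []]⟩ ::
      codeRules f

theorem mem_eval_pair {f g : Code} {n v : ℕ} : v ∈ (Code.pair f g).eval n ↔
    ∃ a ∈ f.eval n, ∃ b ∈ g.eval n, Nat.pair a b = v := by
  simp [Code.eval, Seq.seq]

theorem mem_eval_comp {f g : Code} {n v : ℕ} : v ∈ (Code.comp f g).eval n ↔
    ∃ a ∈ g.eval n, v ∈ f.eval a :=
  Part.mem_bind_iff

theorem mem_eval_prec_succ {f g : Code} {a k v : ℕ} :
    v ∈ (Code.prec f g).eval (Nat.pair a (k + 1)) ↔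
      ∃ y ∈ (Code.prec f g).eval (Nat.pair a k), v ∈ g.eval (Nat.pair a (Nat.pair k y)) := by
  rw [Code.eval_prec_succ]
  simp

/-- The value of `rfind'` is the start of the search plus the number of steps, hence the zero
itself. It therefore stays the same when the start moves, as the recursive rule requires. -/
theorem mem_eval_rfind' {f : Code} {a k v : ℕ} : v ∈ (Code.rfind' f).eval (Nat.pair a k) ↔
    k ≤ v ∧ 0 ∈ f.eval (Nat.pair a v) ∧
      ∀ i, k ≤ i → i < v → ∃ y, y + 1 ∈ f.eval (Nat.pair a i) := by
  simp only [Code.eval, Nat.unpaired, Nat.unpair_pair, Part.map_eq_map, Part.mem_map_iff]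
  constructor
  · rintro ⟨n, hn, rfl⟩
    obtain ⟨h0, hn⟩ := Nat.mem_rfind.1 hn
    refine ⟨by omega, ?_, fun i h1 h2 => ?_⟩
    · obtain ⟨y, hy, hy0⟩ := (Part.mem_map_iff _).1 h0
      rwa [of_decide_eq_true hy0] at hy
    · obtain ⟨y, hy, hy0⟩ := (Part.mem_map_iff _).1 (hn (show i - k < n by omega))
      rw [Nat.sub_add_cancel h1] at hy
      rcases y with _ | y
      · simp at hy0
      · exact ⟨y, hy⟩
  · rintro ⟨hk, h0, hn⟩
    refine ⟨v - k, Nat.mem_rfind.2 ⟨(Part.mem_map_iff _).2 ⟨0, ?_, by simp⟩, fun {i} hi => ?_⟩,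
      by omega⟩
    · rwa [Nat.sub_add_cancel hk]
    · obtain ⟨y, hy⟩ := hn (i + k) (by omega) (by omega)
      exact (Part.mem_map_iff _).2 ⟨y + 1, hy, by simp⟩

/-! ### Soundness of the rules -/

/-- The meaning of a fact. -/
def Fact.Holds (f : Fact) : Prop :=
  (f 0 = 0 → f 3 = Nat.pair (f 1) (f 2)) ∧ ∀ c, f 0 = tag c → f 2 ∈ Code.eval c (f 1)

/-- Tags of codes are nonzero and injective, so only one clause of `Fact.Holds` applies. -/
theorem Fact.holds_of_eval {f : Fact} {c : Code} (h : f 0 = tag c) (hv : f 2 ∈ c.eval (f 1)) :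
    f.Holds := by
  refine ⟨fun h0 => by simp [tag, h0] at h, fun c' hc' => ?_⟩
  rwa [← Encodable.encode_injective (Nat.succ_injective (h.symm.trans hc'))]

theorem Fact.holds_of_pair {f : Fact} (h : f 0 = 0) (hv : f 3 = Nat.pair (f 1) (f 2)) :
    f.Holds := ⟨fun _ => hv, fun c hc => by simp [tag, h] at hc⟩

/-- A rule that derives only facts that hold from facts that hold. -/
def Rule.Sound (R : Rule) : Prop :=
  ∀ h fs, R.Match h fs → (∀ f ∈ fs, Fact.Holds f) → h.Holds

theorem pairRules_sound : ∀ R ∈ pairRules, R.Sound := by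
  simp only [pairRules, List.forall_mem_cons]
  refine ⟨?_, ?_, ?_, ?_, ?_, by simp⟩
  all_goals
    intro h fs hm hH
    simp [Rule.Match] at hm
  · obtain ⟨⟨h0, h1, h2, h3⟩, -⟩ := hm
    exact Fact.holds_of_pair h0 (by simp [h1, h2, h3, Nat.pair])
  all_goals
    obtain ⟨h0, f, rfl, g0, g1, g2, g3⟩ := hm
    have hf := (hH f (by simp)).1 g0
    refine Fact.holds_of_pair (by simp [h0]) ?_
    simp only [Nat.pair] at hf ⊢
    rw [show h 3 = f 3 + 1 by omega, hf]
  · rw [show h 1 = f 1 + 1 by omega, show h 2 = f 2 by omega]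
    split_ifs <;> first | (exfalso; omega) | ring
  · rw [show h 1 = 0 by omega, show h 2 = f 1 + 1 by omega, show f 2 = f 1 by omega]
    split_ifs <;> first | (exfalso; omega) | ring
  · rw [show h 1 = f 1 by omega, show h 2 = f 2 + 1 by omega]
    split_ifs <;> first | (exfalso; omega) | ring
  · rw [show h 1 = f 1 + 1 by omega, show h 2 = 0 by omega, show f 2 = f 1 + 1 by omega]
    split_ifs <;> first | (exfalso; omega) | ring

theorem codeRules_sound (c : Code) : ∀ R ∈ codeRules c, R.Sound := by
  induction c with
  | zero =>
    simp only [codeRules, List.forall_mem_cons]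
    refine ⟨fun h fs hm hH => ?_, by simp⟩
    simp [Rule.Match] at hm
    obtain ⟨⟨h0, h2⟩, -⟩ := hm
    exact Fact.holds_of_eval h0 (by rw [h2]; exact Part.mem_some 0)
  | succ =>
    simp only [codeRules, List.forall_mem_cons]
    refine ⟨fun h fs hm hH => ?_, by simp⟩
    simp [Rule.Match] at hm
    obtain ⟨⟨h0, h2⟩, -⟩ := hm
    exact Fact.holds_of_eval h0 (by simp [Code.eval]; omega)
  | left =>
    simp only [codeRules, List.forall_mem_cons]
    refine ⟨fun h fs hm hH => ?_, by simp⟩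
    simp [Rule.Match] at hm
    obtain ⟨h0, f, rfl, f0, f1, f3⟩ := hm
    have hf := (hH f (by simp)).1 f0
    exact Fact.holds_of_eval h0 (by simp [Code.eval, ← f1, ← f3, hf])
  | right =>
    simp only [codeRules, List.forall_mem_cons]
    refine ⟨fun h fs hm hH => ?_, by simp⟩
    simp [Rule.Match] at hm
    obtain ⟨h0, f, rfl, f0, f1, f3⟩ := hm
    have hf := (hH f (by simp)).1 f0
    exact Fact.holds_of_eval h0 (by simp [Code.eval, ← f1, ← f3, hf])
  | pair cf cg ihf ihg =>
    simp only [codeRules, List.forall_mem_cons, List.forall_mem_append]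
    refine ⟨fun h fs hm hH => ?_, ihf, ihg⟩
    simp [Rule.Match] at hm
    obtain ⟨h0, f, g, q, rfl, ⟨f0, f1⟩, ⟨g0, g1⟩, q0, q1, q2, q3⟩ := hm
    have hf := (hH f (by simp)).2 _ f0
    have hg := (hH g (by simp)).2 _ g0
    have hq := (hH q (by simp)).1 q0
    rw [f1] at hf
    rw [g1] at hg
    exact Fact.holds_of_eval h0 (mem_eval_pair.2 ⟨_, hf, _, hg, by rw [← q3, hq, q1, q2]⟩)
  | comp cf cg ihf ihg =>
    simp only [codeRules, List.forall_mem_cons, List.forall_mem_append]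
    refine ⟨fun h fs hm hH => ?_, ihf, ihg⟩
    simp [Rule.Match] at hm
    obtain ⟨h0, g, f, rfl, ⟨g0, g1⟩, f0, f1, f2⟩ := hm
    have hf := (hH f (by simp)).2 _ f0
    have hg := (hH g (by simp)).2 _ g0
    rw [g1] at hg
    rw [f1, f2] at hf
    exact Fact.holds_of_eval h0 (mem_eval_comp.2 ⟨_, hg, hf⟩)
  | prec cf cg ihf ihg =>
    simp only [codeRules, List.forall_mem_cons, List.forall_mem_append]
    refine ⟨fun h fs hm hH => ?_, fun h fs hm hH => ?_, ihf, ihg⟩ <;> simp [Rule.Match] at hm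
    · obtain ⟨h0, q, f, rfl, ⟨q0, q2, q3⟩, f0, f1, f2⟩ := hm
      have hf := (hH f (by simp)).2 _ f0
      have hq := (hH q (by simp)).1 q0
      refine Fact.holds_of_eval h0 ?_
      rw [← q3, hq, q2, Code.eval_prec_zero, ← f1, ← f2]
      exact hf
    · obtain ⟨h0, q, r, s, x, y, g, rfl, ⟨q0, q3⟩, ⟨r0, r1, r2⟩, ⟨s0, s1⟩, ⟨x0, x1, x2⟩,
        ⟨y0, y1, y2⟩, g0, g1, g2⟩ := hm
      have hq := (hH q (by simp)).1 q0
      have hr := (hH r (by simp)).1 r0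
      have hs := (hH s (by simp)).2 _ s0
      have hx := (hH x (by simp)).1 x0
      have hy := (hH y (by simp)).1 y0
      have hg := (hH g (by simp)).2 _ g0
      refine Fact.holds_of_eval h0 ?_
      rw [s1, hr, r1] at hs
      rw [g1, g2, hy, y1, y2, hx, x1, x2] at hg
      rw [← q3, hq, show q 2 = r 2 + 1 by omega]
      exact mem_eval_prec_succ.2 ⟨_, hs, hg⟩
  | rfind' cf ihf =>
    simp only [codeRules, List.forall_mem_cons]
    refine ⟨fun h fs hm hH => ?_, fun h fs hm hH => ?_, ihf⟩ <;> simp [Rule.Match] at hm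
    · obtain ⟨h0, q, f, rfl, ⟨q0, q2, q3⟩, f0, f1, f2⟩ := hm
      have hf := (hH f (by simp)).2 _ f0
      have hq := (hH q (by simp)).1 q0
      refine Fact.holds_of_eval h0 ?_
      rw [f1, f2, ← q3, hq, q2] at hf
      rw [← q3, hq, q2]
      exact mem_eval_rfind'.2 ⟨le_rfl, hf, fun i h1 h2 => by omega⟩
    · obtain ⟨h0, q, f, r, s, rfl, ⟨q0, q3⟩, ⟨f0, f1, f2⟩, ⟨r0, r1, r2⟩, s0, s1, s2⟩ := hm
      have hq := (hH q (by simp)).1 q0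
      have hf := (hH f (by simp)).2 _ f0
      have hr := (hH r (by simp)).1 r0
      have hs := (hH s (by simp)).2 _ s0
      refine Fact.holds_of_eval h0 ?_
      rw [f1, ← q3, hq] at hf
      rw [s1, s2, hr, r1, show r 2 = q 2 + 1 by omega] at hs
      obtain ⟨hle, hv, hall⟩ := mem_eval_rfind'.1 hs
      rw [← q3, hq]
      refine mem_eval_rfind'.2 ⟨by omega, hv, fun i h1 h2 => ?_⟩
      rcases h1.eq_or_lt with rfl | h1
      · exact ⟨f 2 - 1, by rwa [Nat.sub_add_cancel f2]⟩
      · exact hall i h1 h2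

theorem Derivable.holds {rs : List Rule} (hrs : ∀ R ∈ rs, R.Sound) {f : Fact}
    (h : Derivable rs f) : f.Holds := by
  induction h with
  | intro R hR h fs hm _ ih => exact hrs R hR h fs hm ih

/-! ### Completeness of the rules -/

theorem derivable_pair {rs : List Rule} (hrs : pairRules ⊆ rs) (a b : ℕ) :
    Derivable rs ![0, a, b, Nat.pair a b] := by
  obtain ⟨n, hn⟩ : ∃ n, Nat.pair a b = n := ⟨_, rfl⟩
  rw [hn]
  simp only [pairRules, List.cons_subset] at hrs
  obtain ⟨h1, h2, h3, h4, h5, -⟩ := hrs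
  -- Induction on the value of the pair: each rule other than the first has the preceding pair as
  -- its premise.
  induction n generalizing a b with
  | zero =>
    obtain ⟨rfl, rfl⟩ : a = 0 ∧ b = 0 := by
      have := Nat.left_le_pair a b
      have := Nat.right_le_pair a b
      omega
    exact .intro _ h1 _ [] (by simp [Rule.Match]) (by simp)
  | succ n ih =>
    rcases lt_or_ge a b with hab | hab
    · rcases a with _ | a
      · obtain ⟨b, rfl⟩ := Nat.exists_eq_add_of_lt hab
        refine .intro _ h3 _ [![0, b, b, n]] (by simp [Rule.Match]) ?_
        simp only [List.forall_mem_singleton]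
        refine ih b b ?_
        simp only [Nat.pair] at hn ⊢
        split_ifs at hn ⊢ <;> first | (exfalso; omega) | nlinarith
      · refine .intro _ h2 _ [![0, a, b, n]] (by simp [Rule.Match]; omega) ?_
        simp only [List.forall_mem_singleton]
        refine ih a b ?_
        simp only [Nat.pair] at hn ⊢
        split_ifs at hn ⊢ <;> first | (exfalso; omega) | nlinarith
    · rcases b with _ | b
      · rcases a with _ | a
        · simp [Nat.pair] at hn
        refine .intro _ h5 _ [![0, a, a + 1, n]] (by simp [Rule.Match]) ?_
        simp only [List.forall_mem_singleton]
        refine ih a (a + 1) ?_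
        simp only [Nat.pair] at hn ⊢
        split_ifs at hn ⊢ <;> first | (exfalso; omega) | nlinarith
      · refine .intro _ h4 _ [![0, a, b, n]] (by simp [Rule.Match]; omega) ?_
        simp only [List.forall_mem_singleton]
        refine ih a b ?_
        simp only [Nat.pair] at hn ⊢
        split_ifs at hn ⊢ <;> first | (exfalso; omega) | nlinarith

theorem derivable_eval {rs : List Rule} (hp : pairRules ⊆ rs) {c : Code} (hc : codeRules c ⊆ rs)
    {n v : ℕ} (hv : v ∈ c.eval n) : Derivable rs ![tag c, n, v, 0] := by
  have hpair := derivable_pair hp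
  induction c generalizing n v with
  | zero =>
    simp only [codeRules, List.cons_subset] at hc
    obtain rfl : v = 0 := Part.mem_some_iff.1 hv
    exact .intro _ hc.1 _ [] (by simp [Rule.Match]) (by simp)
  | succ =>
    simp only [codeRules, List.cons_subset] at hc
    obtain rfl : v = n + 1 := Part.mem_some_iff.1 hv
    exact .intro _ hc.1 _ [] (by simp [Rule.Match]) (by simp)
  | left =>
    simp only [codeRules, List.cons_subset] at hc
    obtain rfl : v = n.unpair.1 := Part.mem_some_iff.1 hv
    exact .intro _ hc.1 _ [![0, n.unpair.1, n.unpair.2, Nat.pair n.unpair.1 n.unpair.2]]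
      (by simp [Rule.Match])
      (by simpa only [List.forall_mem_singleton] using hpair n.unpair.1 n.unpair.2)
  | right =>
    simp only [codeRules, List.cons_subset] at hc
    obtain rfl : v = n.unpair.2 := Part.mem_some_iff.1 hv
    exact .intro _ hc.1 _ [![0, n.unpair.1, n.unpair.2, Nat.pair n.unpair.1 n.unpair.2]]
      (by simp [Rule.Match])
      (by simpa only [List.forall_mem_singleton] using hpair n.unpair.1 n.unpair.2)
  | pair cf cg ihf ihg =>
    simp only [codeRules, List.cons_subset, List.append_subset] at hc
    obtain ⟨hR, hcf, hcg⟩ := hc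
    obtain ⟨a, ha, b, hb, rfl⟩ := mem_eval_pair.1 hv
    refine .intro _ hR _ [![tag cf, n, a, 0], ![tag cg, n, b, 0], ![0, a, b, Nat.pair a b]]
      (by simp [Rule.Match]) ?_
    simp only [List.forall_mem_cons]
    exact ⟨ihf hcf ha, ihg hcg hb, hpair _ _, by simp⟩
  | comp cf cg ihf ihg =>
    simp only [codeRules, List.cons_subset, List.append_subset] at hc
    obtain ⟨hR, hcf, hcg⟩ := hc
    obtain ⟨a, ha, hb⟩ := mem_eval_comp.1 hv
    refine .intro _ hR _ [![tag cg, n, a, 0], ![tag cf, a, v, 0]] (by simp [Rule.Match]) ?_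
    simp only [List.forall_mem_cons]
    exact ⟨ihg hcg ha, ihf hcf hb, by simp⟩
  | prec cf cg ihf ihg =>
    simp only [codeRules, List.cons_subset, List.append_subset] at hc
    obtain ⟨hR, hR', hcf, hcg⟩ := hc
    obtain ⟨a, k, rfl⟩ : ∃ a k, Nat.pair a k = n := ⟨_, _, Nat.pair_unpair n⟩
    induction k generalizing v with
    | zero =>
      rw [Code.eval_prec_zero] at hv
      refine .intro _ hR _ [![0, a, 0, Nat.pair a 0], ![tag cf, a, v, 0]]
        (by simp [Rule.Match]) ?_
      simp only [List.forall_mem_cons]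
      exact ⟨hpair _ _, ihf hcf hv, by simp⟩
    | succ k ih =>
      obtain ⟨y, hy, hv⟩ := mem_eval_prec_succ.1 hv
      refine .intro _ hR' _ [![0, a, k + 1, Nat.pair a (k + 1)], ![0, a, k, Nat.pair a k],
        ![tag (.prec cf cg), Nat.pair a k, y, 0], ![0, k, y, Nat.pair k y],
        ![0, a, Nat.pair k y, Nat.pair a (Nat.pair k y)],
        ![tag cg, Nat.pair a (Nat.pair k y), v, 0]] (by simp [Rule.Match]) ?_
      simp only [List.forall_mem_cons]
      exact ⟨hpair _ _, hpair _ _, ih hy, hpair _ _, hpair _ _, ihg hcg hv, by simp⟩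
  | rfind' cf ihf =>
    simp only [codeRules, List.cons_subset] at hc
    obtain ⟨hR, hR', hcf⟩ := hc
    obtain ⟨a, k, rfl⟩ : ∃ a k, Nat.pair a k = n := ⟨_, _, Nat.pair_unpair n⟩
    obtain ⟨hkv, h0, hall⟩ := mem_eval_rfind'.1 hv
    clear hv
    -- The search is followed backwards, from the zero at `v` down to its start `k`.
    induction hkv using Nat.decreasingInduction with
    | self =>
      refine .intro _ hR _ [![0, a, v, Nat.pair a v], ![tag cf, Nat.pair a v, 0, 0]]
        (by simp [Rule.Match]) ?_
      simp only [List.forall_mem_cons]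
      exact ⟨hpair _ _, ihf hcf h0, by simp⟩
    | of_succ k hk ih =>
      obtain ⟨y, hy⟩ := hall k le_rfl hk
      refine .intro _ hR' _ [![0, a, k, Nat.pair a k], ![tag cf, Nat.pair a k, y + 1, 0],
        ![0, a, k + 1, Nat.pair a (k + 1)], ![tag (.rfind' cf), Nat.pair a (k + 1), v, 0]]
        (by simp [Rule.Match]) ?_
      simp only [List.forall_mem_cons]
      exact ⟨hpair _ _, ihf hcf hy, hpair _ _, ih fun i h1 h2 => hall i (by omega) h2, by simp⟩

/-- The rules for pairing and for a code. -/
def rules (c : Code) : List Rule := pairRules ++ codeRules c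

theorem exists_derivable_rules_iff {c : Code} {n : ℕ} :
    (∃ f, Derivable (rules c) f ∧ f 0 = tag c ∧ f 1 = n) ↔ (c.eval n).Dom := by
  rw [Part.dom_iff_mem]
  constructor
  · rintro ⟨f, hf, h0, rfl⟩
    exact ⟨f 2, (hf.holds (List.forall_mem_append.2 ⟨pairRules_sound, codeRules_sound c⟩)).2 c h0⟩
  · rintro ⟨v, hv⟩
    exact ⟨_, derivable_eval (List.subset_append_left _ _) (List.subset_append_right _ _) hv,
      rfl, rfl⟩

/-! ### Computability of the reduction -/

open Encodable (encode)

theorem encode_single (n : ℕ) : encode (Interval.single n) =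
    Nat.pair (2 * (2 * n) + 1) (2 * (2 * n) + 1) := by
  have h : encode (n : ℤ) = 2 * n := rfl
  change Nat.pair (2 * encode (n : ℤ) + 1) (2 * encode (n : ℤ) + 1) = _
  rw [h]

theorem computable_derives {m : ℕ} (p : Fin m) (rs : List Rule) (t : ℕ) :
    Computable (TPTL.derives p rs t) := by
  refine Computable.encode_iff.1 (Primrec.to_comp ?_)
  -- Only one interval depends on `n`. The codes of all constant subformulas, among them the whole
  -- of `derivation`, are hidden behind existential variables, leaving a nest of pairings.
  have h : ∃ a b c d e : ℕ, ∀ n, encode (TPTL.derives p rs t n) =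
      m + (5 * Nat.pair (m + (5 * Nat.pair a (m + (5 * Nat.pair b (m + (5 * Nat.pair c
        (m + (5 * Nat.pair d (m + 5 * Nat.pair 0 (encode (Interval.single n))) + 3)) + 2)) + 2))
          + 3)) e + 2) := ⟨_, _, _, _, _, fun _ => rfl⟩
  obtain ⟨a, b, c, d, e, h⟩ := h
  simp only [h, encode_single]
  have add (k : ℕ) {f : ℕ → ℕ} (hf : Primrec f) : Primrec fun n => f n + k :=
    Primrec.nat_add.comp hf (Primrec.const k)
  have mul (k : ℕ) {f : ℕ → ℕ} (hf : Primrec f) : Primrec fun n => k * f n :=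
    Primrec.nat_mul.comp (Primrec.const k) hf
  have pair {f g : ℕ → ℕ} (hf : Primrec f) (hg : Primrec g) :
      Primrec fun n => Nat.pair (f n) (g n) := Primrec₂.natPair.comp hf hg
  have const (k : ℕ) : Primrec fun _ : ℕ => k := Primrec.const k
  have code (k : ℕ) {f : ℕ → ℕ} (hf : Primrec f) : Primrec fun n => m + (5 * f n + k) :=
    Primrec.nat_add.comp (const m) (add k (mul 5 hf))
  have hn := add 1 (mul 2 (mul 2 Primrec.id))
  exact code 2 (pair (code 3 (pair (const a) (code 2 (pair (const b) (code 2 (pair (const c)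
    (code 3 (pair (const d) (code 0 (pair (const 0) (pair hn hn))))))))))) (const e))

/-- There is a code whose domain is the halting problem. -/
theorem exists_universal_code : ∃ u : Nat.Partrec.Code, ∀ c : Nat.Partrec.Code,
    (u.eval (encode c)).Dom ↔ (c.eval 0).Dom := by
  have h : Partrec fun n : ℕ => (Denumerable.ofNat Nat.Partrec.Code n).eval 0 :=
    Nat.Partrec.Code.eval_part.comp (Computable.ofNat _) (Computable.const 0)
  obtain ⟨u, hu⟩ := Nat.Partrec.Code.exists_code.1 (Partrec.nat_iff.1 h)
  exact ⟨u, fun c => by rw [hu]; simp⟩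

end DataLogic

theorem mainTheorem5 (m : ℕ) (hm : 0 < m) :
    ¬ ComputablePred (fun φ : DataLogic.TPTL m => DataLogic.DefinableInMTL φ.language) := by
  intro hdec
  obtain ⟨u, hu⟩ := DataLogic.exists_universal_code
  have hred : ComputablePred fun c : Nat.Partrec.Code => DataLogic.DefinableInMTL
      (DataLogic.TPTL.derives ⟨0, hm⟩ (DataLogic.rules u) (DataLogic.tag u)
        (Encodable.encode c)).language :=
    let ⟨_, h⟩ := hdec
    ⟨fun _ => inferInstance, h.comp ((DataLogic.computable_derives _ _ _).comp Computable.encode)⟩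
  -- Non-definability for input `encode c` says that `u` halts there, that is, that `c` halts at
  -- `0`.
  refine ComputablePred.halting_problem 0 (hred.not.of_eq fun c => ?_)
  rw [DataLogic.definableInMTL_derives_iff, not_not, DataLogic.exists_derivable_rules_iff, hu]
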